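/- Let $\mathbf F$ be a finite field of characteristic $p\neq 2$. A *Coxeter arrangement over $\mathbf F$* is a triple $A=(V,G,q)$ where $V$ is a finite-dimensional $\mathbf F$-vector space, $G\subset \mathrm{GL}(V)$ is a finite subgroup generated by reflections (elements of order $2$ fixing pointwise some hyperplane), and $q$ is a $G$-invariant nondegenerate symmetric bilinear form on $V$. A *complex Coxeter arrangement* is such a triple over $\mathbf C$ which arises by extension of scalars from a triple over $\mathbf R$ of the same kind with positive definite form. If $T\subset\mathbf C$ is a discrete valuation ring with residue field $\mathbf F$ and fraction field of finite degree over $\mathbf Q$, a *Coxeter arrangement over $T$* is a triple $A_T=(M_T,G_T,q_T)$ with $M_T$ a free $T$-module of finite rank, $G_T\subset\mathrm{GL}(M_T)$ a finite subgroup generated by reflections and $q_T$ a $G_T$-invariant nondegenerate symmetric bilinear form, which induces by extension of scalars a complex Coxeter arrangement $A_T\otimes_T\mathbf C$. It is a *lifting* of $A$ over $T$ if there is an isomorphism $M_T\otimes_T\mathbf F\cong V$ under which the image of $G_T$ in $\mathrm{GL}(V)$ is $G$ and the form induced by $q_T$ is $q$; $A$ is *liftable* if it has a lifting over some such $T$.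 For a triple $(V,G,q)$ over a field $k$, with $n=\dim V$, a multiset $\{d_1,\dots,d_n\}$ is a *multiset of degrees* if the algebra $S(V)^G$ of $G$-invariants in the symmetric algebra $S(V)$ is generated by $n$ algebraically independent homogeneous elements of degrees $d_1,\dots,d_n$. **Proposition 1.5.** Let $A=(V,G,q)$ be a liftable Coxeter arrangement over $\mathbf F$, and assume that $p$ does not divide $|G|$. Then $A$ has exactly one multiset of degrees $\{d_1,\dots,d_n\}$, and for every lifting $A_T=(M_T,G_T,q_T)$ of $A$ such that $p$ does not divide $|G_T|$ (equivalently, such that the reduction map $G_T\to G$ is an isomorphism), this is also the one and only multiset of degrees of the complex Coxeter arrangement $A_T\otimes_T\mathbf C$. -/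

import Mathlib

open scoped TensorProduct

noncomputable section

/-- A reflection of an `R`-module `M`: an automorphism of order two that fixes pointwise a hyperplane,
i.e. the kernel of some nonzero linear form. Over a field this is the usual notion.
If `R` is a domain with fraction field `K` and `M` is free of finite rank, it says precisely that the
automorphism induced on `M ⊗ K` is a reflection. -/
def IsLinearReflection {R M : Type*} [CommRing R] [AddCommGroup M] [Module R M]
    (s : M ≃ₗ[R] M) : Prop :=
  orderOf s = 2 ∧ ∃ l : Module.Dual R M, l ≠ 0 ∧ ∀ x : M, l x = 0 → s x = x

/-- The group homomorphism `GL(M) → GL(S ⊗ M)` given by extension of scalars from `R` to `S`. -/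
def extendScalarsHom (R S M : Type*) [CommRing R] [CommRing S] [Algebra R S]
    [AddCommGroup M] [Module R M] :
    (M ≃ₗ[R] M) →* ((S ⊗[R] M) ≃ₗ[S] (S ⊗[R] M)) where
  toFun g := g.baseChange R S M M
  map_one' := LinearEquiv.baseChange_one R S M
  map_mul' g h := LinearEquiv.baseChange_mul R S M g h

/-- The group homomorphism `GL(M) → GL(N)`, `g ↦ e ∘ g ∘ e⁻¹`, attached to an isomorphism
`e : M ≃ N`. -/
def conjugationHom {R M N : Type*} [CommRing R] [AddCommGroup M] [Module R M]
    [AddCommGroup N] [Module R N] (e : M ≃ₗ[R] N) : (M ≃ₗ[R] M) →* (N ≃ₗ[R] N) where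
  toFun g := (e.symm.trans g).trans e
  map_one' := by ext x; simp
  map_mul' g h := by ext x; simp

/-- The raw data `(M, G, q)`: a subgroup `G` of `GL(M)` and a bilinear form `q` on `M`. The axioms
of a Coxeter arrangement over the various base rings are imposed below. -/
structure ArrangementData (R M : Type*) [CommRing R] [AddCommGroup M] [Module R M] where
  /-- the group -/
  G : Subgroup (M ≃ₗ[R] M)
  /-- the bilinear form -/
  q : LinearMap.BilinForm R M

namespace ArrangementData

/-- Extension of scalars of `(M, G, q)` to an `R`-algebra `S`: the module `S ⊗ M`, the image of `G` in
`GL(S ⊗ M)`, and the induced bilinear form. If `S` is a residue field of `R`, this is the reduction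
of `(M, G, q)`. -/
def baseChange {R M : Type*} [CommRing R] [AddCommGroup M] [Module R M]
    (A : ArrangementData R M) (S : Type*) [CommRing S] [Algebra R S] :
    ArrangementData S (S ⊗[R] M) where
  G := A.G.map (extendScalarsHom R S M)
  q := A.q.baseChange S

/-- Transport of `(M, G, q)` along an isomorphism `e : M ≃ N`. -/
def transport {R M N : Type*} [CommRing R] [AddCommGroup M] [Module R M]
    [AddCommGroup N] [Module R N] (A : ArrangementData R M) (e : M ≃ₗ[R] N) :
    ArrangementData R N where
  G := A.G.map (conjugationHom e)
  q := LinearMap.BilinForm.congr e A.q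

/-- `G` is a finite group generated by reflections, and `q` is a `G`-invariant nondegenerate symmetric
bilinear form. For a finite dimensional vector space over a finite field, this is the definition of
a Coxeter arrangement. -/
structure IsCoxeter {R M : Type*} [CommRing R] [AddCommGroup M] [Module R M]
    (A : ArrangementData R M) : Prop where
  finite : Finite A.G
  generated : Subgroup.closure {s | s ∈ A.G ∧ IsLinearReflection s} = A.G
  symm : ∀ x y, A.q x y = A.q y x
  nondegenerate : A.q.Nondegenerate
  invariant : ∀ g ∈ A.G, ∀ x y, A.q (g x) (g y) = A.q x y

/-- A classical Coxeter arrangement: over `ℝ`, with `q` positive definite. -/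
structure IsClassicalCoxeter {W : Type*} [AddCommGroup W] [Module ℝ W]
    (A : ArrangementData ℝ W) : Prop where
  isCoxeter : A.IsCoxeter
  posDef : ∀ x, x ≠ 0 → 0 < A.q x x

/-- A Coxeter arrangement over `ℂ`: one which arises by extension of scalars from a classical Coxeter
arrangement on a finite dimensional real vector space. -/
def IsComplexCoxeter {V : Type*} [AddCommGroup V] [Module ℂ V]
    (A : ArrangementData ℂ V) : Prop :=
  A.IsCoxeter ∧
    ∃ (W : Type) (_ : AddCommGroup W) (_ : Module ℝ W) (_ : FiniteDimensional ℝ W)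
      (B : ArrangementData ℝ W) (e : (ℂ ⊗[ℝ] W) ≃ₗ[ℂ] V),
      B.IsClassicalCoxeter ∧ (B.baseChange ℂ).transport e = A

/-- A Coxeter arrangement over a ring `T` embedded in `ℂ`: it induces by extension of scalars a Coxeter
arrangement over `ℂ`. -/
structure IsCoxeterOver {T M : Type*} [CommRing T] [Algebra T ℂ] [AddCommGroup M] [Module T M]
    (A : ArrangementData T M) : Prop where
  isCoxeter : A.IsCoxeter
  isComplexCoxeter : (A.baseChange ℂ).IsComplexCoxeter

/-- The algebra automorphism (here: endomorphism) of the symmetric algebra `S(V)` induced by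
`g ∈ GL(V)`. -/
def symAction {k V : Type*} [CommRing k] [AddCommGroup V] [Module k V] (g : V ≃ₗ[k] V) :
    SymmetricAlgebra k V →ₐ[k] SymmetricAlgebra k V :=
  SymmetricAlgebra.lift (SymmetricAlgebra.ι k V ∘ₗ (g : V →ₗ[k] V))

/-- The subalgebra of `G`-invariants of the symmetric algebra `S(V)`. -/
def invariants {k V : Type*} [CommRing k] [AddCommGroup V] [Module k V]
    (A : ArrangementData k V) : Subalgebra k (SymmetricAlgebra k V) where
  carrier := {f | ∀ g ∈ A.G, symAction g f = f}
  mul_mem' ha hb g hg := by rw [map_mul, ha g hg, hb g hg]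
  add_mem' ha hb g hg := by rw [map_add, ha g hg, hb g hg]
  algebraMap_mem' r g _ := (symAction g).commutes r

/-- The multiset `d` is a system of degrees of `(V, G, q)`: with `n = dim V`, the algebra of
`G`-invariants of `S(V)` is generated by `n` algebraically independent elements which are homogeneous and
whose degrees are the members of `d`, with multiplicity. The homogeneous part of degree `m` of `S(V)` is the
span of the products of `m` vectors, i.e. the `m`-th power of the image of `V`. -/
def HasDegrees {k V : Type*} [Field k] [AddCommGroup V] [Module k V]
    (A : ArrangementData k V) (d : Multiset ℕ) : Prop :=
  ∃ (f : Fin (Module.finrank k V) → SymmetricAlgebra k V) (deg : Fin (Module.finrank k V) → ℕ),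
    AlgebraicIndependent k f ∧
    Algebra.adjoin k (Set.range f) = A.invariants ∧
    (∀ i, f i ∈ LinearMap.range (SymmetricAlgebra.ι k V) ^ deg i) ∧
    d = Finset.univ.val.map deg

end ArrangementData

/-- `T` is a discrete valuation ring embedded in `ℂ`, with fraction field of finite degree over `ℚ` and
with residue field `F`. As `F` is a field, a surjective ring homomorphism `T → F` is the same
thing as an identification of `F` with the residue field of `T`. -/
structure IsLiftingRing (T F : Type*) [CommRing T] [IsDomain T] [Field F]
    [Algebra T ℂ] [Algebra T F] : Prop where
  isDiscreteValuationRing : IsDiscreteValuationRing T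
  embedding : Function.Injective (algebraMap T ℂ)
  residueField : Function.Surjective (algebraMap T F)
  numberField : NumberField (FractionRing T)

namespace ArrangementData

/-- `B = (M, G_T, q_T)` is a lifting over `T` of `A = (V, G, q)`: `B` is a Coxeter arrangement over `T` and,
after identification of `F ⊗ M` with `V` by a suitable isomorphism, the image of `G_T` in `GL(V)` is `G` and
the form induced by `q_T` on `V` is `q`. -/
def IsLifting {T F M V : Type*} [CommRing T] [Field F] [Algebra T ℂ] [Algebra T F]
    [AddCommGroup M] [Module T M] [AddCommGroup V] [Module F V]
    (B : ArrangementData T M) (A : ArrangementData F V) : Prop :=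
  B.IsCoxeterOver ∧ ∃ e : (F ⊗[T] M) ≃ₗ[F] V, (B.baseChange F).transport e = A

/-- `A` is liftable: it has a lifting over some discrete valuation ring `T ⊆ ℂ` with residue field `F` and
fraction field of finite degree over `ℚ`, on a free `T`-module of finite rank. -/
def IsLiftable {F V : Type*} [Field F] [AddCommGroup V] [Module F V]
    (A : ArrangementData F V) : Prop :=
  ∃ (T : Type) (_ : CommRing T) (_ : IsDomain T) (_ : Algebra T ℂ) (_ : Algebra T F)
    (M : Type) (_ : AddCommGroup M) (_ : Module T M) (B : ArrangementData T M),
    IsLiftingRing T F ∧ Module.Free T M ∧ Module.Finite T M ∧ B.IsLifting A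

end ArrangementData

end

/-! Existence of degrees is the theorem of Chevalley, Shephard and Todd for a reflection group of
order invertible in the field; it serves both over `F` and over `ℂ`. Take as few homogeneous
invariants `f` of positive degree as possible that generate the ideal of all invariants without
constant term. By averaging they generate the algebra of invariants. Chevalley's lemma
(`syzygy_mem_span_invariants`) says that all syzygies of `f` have coefficients in the ideal `(f)`. A
comparison of Koszul complexes (`card_le_of_syzygies_mem`) then bounds their number by `n`, and
since the polynomial ring is integral over the invariants, they form a transcendence basis.

Uniqueness comes from the Hilbert function of the invariants: its generating series is the inverse
of `∏ (1 - X ^ d i)`, and this product determines the multiset of the `d i`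
(`eq_of_weightCount_eq`).

For a lifting, the order of `G_T` is a unit of `T`, so the averaging operator is defined over `T`
and is compatible with both `T → F` and `T → ℂ`. Hence the invariants of degree `m` over `F` and
over `ℂ` have the same dimension, namely the rank of those over `T` (`finrank_polyInvariants_map`).
The two Hilbert functions agree, and so do the degrees. -/

noncomputable section

open MvPolynomial

/-! ### Koszul complexes and the number of generators -/

/-- If `f` lies in the ideal generated by `x`, and if all syzygies of `f` have coefficients in the ideal
generated by `f`, then `f` has no more members than `x`. The proof compares the Koszul complexes of `f`
and `x`. -/
theorem card_le_of_syzygies_mem {S : Type*} [CommRing S] [IsDomain S] {m n : ℕ}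
    (f : Fin m → S) (x : Fin n → S) (hfx : ∀ j, f j ∈ Ideal.span (Set.range x))
    (hx : Ideal.span (Set.range x) ≠ ⊤)
    (H : ∀ r : Fin m → S, ∑ j, r j * f j = 0 → ∀ j, r j ∈ Ideal.span (Set.range f)) :
    m ≤ n := by
  set J := Ideal.span (Set.range x) with hJ
  choose a ha using fun j => Ideal.mem_span_range_iff_exists_fun.1 (hfx j)
  -- Contraction with `δ` is the Koszul differential `D` of `x`. The vectors `a j` lift the `f j`
  -- along `δ`, so the products of the `w j` are images from the Koszul complex of `f`.
  let δ : Module.Dual S (Fin n → S) := ∑ k, x k • LinearMap.proj k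
  have hδ : ∀ v, δ v = ∑ k, v k * x k := fun v => by
    simp [δ, LinearMap.sum_apply, mul_comm]
  have hδa : ∀ j, δ (a j) = f j := fun j => by rw [hδ, ha]
  let E := ExteriorAlgebra S (Fin n → S)
  let D : E →ₗ[S] E := CliffordAlgebra.contractLeft (Q := (0 : QuadraticForm S (Fin n → S))) δ
  let w : Fin m → E := fun j => ExteriorAlgebra.ι S (a j)
  have hDι : ∀ v (b : E), D (ExteriorAlgebra.ι S v * b) =
      δ v • b - ExteriorAlgebra.ι S v * D b := fun v b =>
    CliffordAlgebra.contractLeft_ι_mul (Q := (0 : QuadraticForm S (Fin n → S))) (d := δ) v b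
  have hDD : ∀ b : E, D (D b) = 0 := fun b =>
    CliffordAlgebra.contractLeft_contractLeft (Q := (0 : QuadraticForm S (Fin n → S))) (d := δ) b
  have hD1 : D 1 = 0 :=
    CliffordAlgebra.contractLeft_one (Q := (0 : QuadraticForm S (Fin n → S))) (d := δ)
  have hDJ : ∀ v : E, ExteriorAlgebra.algebraMapInv (D v) ∈ J := by
    intro v
    induction v using CliffordAlgebra.left_induction with
    | algebraMap r =>
      have : D (algebraMap S E r) = 0 := CliffordAlgebra.contractLeft_algebraMap (d := δ) _ r
      erw [this]
      simp
    | add a b ha hb =>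
      rw [map_add, map_add]
      exact J.add_mem ha hb
    | ι_mul b v hb =>
      have h1 := hDι v b
      erw [h1]
      rw [map_sub, map_smul, map_mul]
      have h2 : ExteriorAlgebra.algebraMapInv (ExteriorAlgebra.ι S v) = 0 := by
        simp [ExteriorAlgebra.algebraMapInv]
      rw [h2, zero_mul, sub_zero, smul_eq_mul]
      refine J.mul_mem_right _ ?_
      rw [hδ]
      exact Ideal.mem_span_range_iff_exists_fun.2 ⟨v, rfl⟩
  -- Antiderivation rule. The vanishing of `c` off the list is what removes the term `w j * c j` in
  -- `key`.
  have hDω : ∀ l : List (Fin m), ∃ c : Fin m → E,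
      D (l.map w).prod = ∑ i, f i • c i ∧ ∀ i, i ∉ l → c i = 0 := by
    intro l
    induction l with
    | nil => exact ⟨0, by simp [hD1], by simp⟩
    | cons j l ih =>
      obtain ⟨c, hc, hc0⟩ := ih
      refine ⟨fun i => Pi.single (M := fun _ => E) j (l.map w).prod i - w j * c i, ?_, ?_⟩
      · rw [List.map_cons, List.prod_cons]
        simp only [w] at hc ⊢
        rw [hDι, hc, hδa]
        simp [smul_sub, Finset.sum_sub_distrib, Finset.mul_sum, Pi.single_apply]
      · intro i hi
        simp only [List.mem_cons, not_or] at hi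
        simp [hi.1, hc0 i hi.2]
  let B := (Pi.basisFun S (Fin n)).ExteriorAlgebra
  -- The exterior algebra is free, so the hypothesis on syzygies applies to each coordinate.
  have hsyz : ∀ z : Fin m → E, ∑ i, f i • z i = 0 → ∀ i, ∃ u : Fin m → E, z i = ∑ k, f k • u k := by
    intro z hz i
    have h1 : ∀ s, ∃ r : Fin m → S, ∑ k, r k * f k = B.repr (z i) s := by
      intro s
      refine Ideal.mem_span_range_iff_exists_fun.1 (H (fun j => B.repr (z j) s) ?_ i)
      have := congrArg (fun y => B.repr y s) hz
      simpa [Finsupp.finsetSum_apply, mul_comm] using this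
    choose r hr using h1
    refine ⟨fun k => ∑ s, r s k • B s, ?_⟩
    rw [← B.sum_repr (z i)]
    simp_rw [← hr, Finset.sum_smul, Finset.smul_sum, smul_smul]
    rw [Finset.sum_comm]
    simp_rw [mul_comm]
  -- No product of distinct `w j` lies in `f E + D E`. Applying `D` to such an expression of `w j *
  -- ω` gives a syzygy of `f` over `E`; its coefficient at `j` being in `f E` puts the shorter
  -- product `ω` in `f E + D E`. The empty product is excluded because the augmentation maps `f E +
  -- D E` into the proper ideal `J`.
  have key : ∀ l : List (Fin m), l.Nodup → ∀ (u : Fin m → E) (v : E),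
      (l.map w).prod ≠ ∑ i, f i • u i + D v := by
    intro l
    induction l with
    | nil =>
      intro _ u v h
      apply hx
      rw [Ideal.eq_top_iff_one]
      have := congrArg (ExteriorAlgebra.algebraMapInv) h
      simp only [List.map_nil, List.prod_nil, map_one, map_add, map_sum, map_smul] at this
      rw [this]
      exact J.add_mem (J.sum_mem fun i _ => J.mul_mem_right _ (hfx i)) (hDJ v)
    | cons j l ih =>
      intro hnd u v h
      rw [List.nodup_cons] at hnd
      obtain ⟨c, hc, hc0⟩ := hDω l
      have h1 := congrArg D h
      rw [List.map_cons, List.prod_cons, map_add, hDD, add_zero, map_sum] at h1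
      simp only [w] at h1 hc
      rw [hDι, hc, hδa] at h1
      obtain ⟨u', hu'⟩ := hsyz (fun i => Pi.single (M := fun _ => E) j (l.map w).prod i
        - w j * c i - D (u i)) (by
          simp only [smul_sub, Finset.sum_sub_distrib]
          simp only [map_smul] at h1
          rw [← h1]
          simp [Finset.mul_sum, Pi.single_apply, w]) j
      refine ih hnd.2 u' (D 0 + u j) ?_
      rw [← hu']
      simp [hc0 j hnd.1]
  -- If `m > n`, the `a j` are linearly dependent, so the product of all `w j` is zero, against
  -- `key`.
  by_contra hlt
  refine key (List.finRange m) (List.nodup_finRange m) 0 0 ?_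
  have := Module.Free.of_basis B
  have h0 : ExteriorAlgebra.ιMulti S m a = 0 := by
    refine AlternatingMap.map_linearDependent _ _ fun h => hlt ?_
    simpa using h.fintype_card_le_finrank
  rw [ExteriorAlgebra.ιMulti_apply] at h0
  simp only [Pi.zero_apply, smul_zero, Finset.sum_const_zero, map_zero, add_zero]
  rw [← h0, List.ofFn_eq_map]

/-! ### Homogeneous components -/

namespace MvPolynomial

section Components

variable {σ R : Type*} [CommRing R]

/-- The case distinction guards against the truncated subtraction `e - d`. -/
theorem homogeneousComponent_mul_of_isHomogeneous {f : MvPolynomial σ R} {d : ℕ}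
    (hf : f.IsHomogeneous d) (r : MvPolynomial σ R) (e : ℕ) :
    homogeneousComponent e (r * f) =
      (if d ≤ e then homogeneousComponent (e - d) r else 0) * f := by
  have h1 : ∀ i, homogeneousComponent e (homogeneousComponent i r * f) =
      if e = i + d then homogeneousComponent i r * f else 0 := fun i =>
    homogeneousComponent_of_mem ((homogeneousComponent_isHomogeneous i r).mul hf)
  conv_lhs => rw [← sum_homogeneousComponent r]
  rw [Finset.sum_mul, map_sum, Finset.sum_congr rfl fun i _ => h1 i]
  split_ifs with h
  · rw [Finset.sum_eq_single (e - d)]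
    · rw [if_pos (by omega)]
    · intro i _ hi
      rw [if_neg (by omega)]
    · intro hi
      rw [Finset.mem_range] at hi
      rw [homogeneousComponent_eq_zero _ _ (by omega)]
      simp
  · rw [zero_mul]
    exact Finset.sum_eq_zero fun i _ => if_neg (by omega)

theorem IsHomogeneous.constantCoeff_eq_zero {f : MvPolynomial σ R} {d : ℕ}
    (hf : f.IsHomogeneous d) (hd : d ≠ 0) : constantCoeff f = 0 := by
  rw [constantCoeff_eq]
  exact hf.coeff_eq_zero (by simpa using hd.symm)

theorem mem_span_range_X_of_constantCoeff_eq_zero {f : MvPolynomial σ R}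
    (hf : constantCoeff f = 0) :
    f ∈ Ideal.span (Set.range (X : σ → MvPolynomial σ R)) := by
  rw [← Set.image_univ, mem_ideal_span_X_image]
  intro m hm
  by_contra! h
  have : m = 0 := Finsupp.ext fun i => h i (Set.mem_univ i)
  subst this
  rw [mem_support_iff] at hm
  exact hm hf

theorem span_range_X_ne_top [Nontrivial R] :
    Ideal.span (Set.range (X : σ → MvPolynomial σ R)) ≠ ⊤ := by
  intro h
  have h1 : Ideal.span (Set.range (X : σ → MvPolynomial σ R)) ≤ RingHom.ker constantCoeff := by
    rw [Ideal.span_le]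
    rintro _ ⟨i, rfl⟩
    simp
  rw [h] at h1
  have := h1 (Submodule.mem_top (x := (1 : MvPolynomial σ R)))
  simp at this

end Components

/-! ### Linear substitutions -/

section LinSubst

variable {ι R : Type*} [Fintype ι] [CommRing R]

/-- The linear substitution `X i ↦ ∑ j, M j i * X j`. -/
def linSubst (M : Matrix ι ι R) : MvPolynomial ι R →ₐ[R] MvPolynomial ι R :=
  aeval fun i => ∑ j, C (M j i) * X j

@[simp]
theorem linSubst_X (M : Matrix ι ι R) (i : ι) : linSubst M (X i) = ∑ j, C (M j i) * X j := by
  simp [linSubst]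

theorem isHomogeneous_linSubst_X (M : Matrix ι ι R) (i : ι) :
    (linSubst M (X i)).IsHomogeneous 1 := by
  rw [linSubst_X]
  exact IsHomogeneous.sum _ _ _ fun j _ => isHomogeneous_C_mul_X _ _

theorem linSubst_one [DecidableEq ι] : linSubst (1 : Matrix ι ι R) = AlgHom.id R _ := by
  refine algHom_ext fun i => ?_
  simp [Matrix.one_apply, Finset.sum_ite_eq', apply_ite C, ite_mul]

theorem linSubst_mul (M N : Matrix ι ι R) :
    linSubst (M * N) = (linSubst M).comp (linSubst N) := by
  refine algHom_ext fun i => ?_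
  simp only [linSubst_X, AlgHom.comp_apply, map_sum, map_mul, Matrix.mul_apply, Finset.sum_mul,
    Finset.mul_sum]
  rw [Finset.sum_comm]
  refine Finset.sum_congr rfl fun j _ => Finset.sum_congr rfl fun l _ => ?_
  rw [← algebraMap_eq, AlgHom.commutes]
  ring

theorem IsHomogeneous.linSubst {p : MvPolynomial ι R} {d : ℕ} (hp : p.IsHomogeneous d)
    (M : Matrix ι ι R) : (MvPolynomial.linSubst M p).IsHomogeneous d := by
  have := hp.aeval (fun i => ∑ j, C (M j i) * X j) (n := 1) fun i =>
    linSubst_X M i ▸ isHomogeneous_linSubst_X M i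
  rwa [one_mul] at this

theorem linSubst_homogeneousComponent (M : Matrix ι ι R) (d : ℕ) (p : MvPolynomial ι R) :
    linSubst M (homogeneousComponent d p) = homogeneousComponent d (linSubst M p) := by
  have h1 : ∀ i, homogeneousComponent d (linSubst M (homogeneousComponent i p)) =
      if d = i then linSubst M (homogeneousComponent i p) else 0 := fun i =>
    homogeneousComponent_of_mem ((homogeneousComponent_isHomogeneous i p).linSubst M)
  conv_rhs => rw [← sum_homogeneousComponent p]
  rw [map_sum, map_sum, Finset.sum_congr rfl fun i _ => h1 i, Finset.sum_ite_eq]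
  split_ifs with h
  · rfl
  · rw [homogeneousComponent_eq_zero _ _ (by simpa using h), map_zero]

theorem totalDegree_linSubst_le (M : Matrix ι ι R) (p : MvPolynomial ι R) :
    (linSubst M p).totalDegree ≤ p.totalDegree := by
  conv_lhs => rw [← sum_homogeneousComponent p]
  rw [map_sum]
  refine totalDegree_finsetSum_le fun i hi => ?_
  have := ((homogeneousComponent_isHomogeneous i p).linSubst M).totalDegree_le
  simp only [Finset.mem_range] at hi
  omega

theorem map_linSubst {S : Type*} [CommRing S] (φ : R →+* S) (M : Matrix ι ι R)
    (p : MvPolynomial ι R) :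
    map φ (linSubst M p) = linSubst (M.map φ) (map φ p) := by
  induction p using MvPolynomial.induction_on with
  | C a => simp [linSubst, algebraMap_eq]
  | add p q hp hq => simp only [map_add, hp, hq]
  | mul_X p i hp => simp [map_mul, hp, map_sum]

/-- The map `p ↦ linSubst M p - p` is a twisted derivation, so divisibility by `L` needs checking on
the variables only. -/
theorem dvd_linSubst_sub {M : Matrix ι ι R} {L : MvPolynomial ι R}
    (hL : ∀ i, L ∣ linSubst M (X i) - X i) (p : MvPolynomial ι R) : L ∣ linSubst M p - p := by
  induction p using MvPolynomial.induction_on with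
  | C a => simp [linSubst, algebraMap_eq]
  | add p q hp hq =>
    rw [map_add, add_sub_add_comm]
    exact dvd_add hp hq
  | mul_X p i hp =>
    have : linSubst M (p * X i) - p * X i =
        linSubst M p * (linSubst M (X i) - X i) + (linSubst M p - p) * X i := by
      rw [map_mul]; ring
    rw [this]
    exact dvd_add (dvd_mul_of_dvd_right (hL i) _) (dvd_mul_of_dvd_left hp _)

end LinSubst

/-! ### Invariants and averaging -/

section Invariants

variable {ι R G : Type*} [Fintype ι] [DecidableEq ι] [CommRing R] [Group G]

theorem linSubst_map_mul (ρ : G →* Matrix ι ι R) (g h : G) (p : MvPolynomial ι R) :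
    linSubst (ρ (g * h)) p = linSubst (ρ g) (linSubst (ρ h) p) := by
  rw [map_mul, linSubst_mul, AlgHom.comp_apply]

theorem linSubst_map_one (ρ : G →* Matrix ι ι R) (p : MvPolynomial ι R) :
    linSubst (ρ 1) p = p := by
  rw [map_one, linSubst_one, AlgHom.id_apply]

/-- The polynomials invariant under a linear representation. -/
def polyInvariants (ρ : G →* Matrix ι ι R) : Subalgebra R (MvPolynomial ι R) where
  carrier := {p | ∀ g, linSubst (ρ g) p = p}
  mul_mem' ha hb g := by rw [map_mul, ha g, hb g]
  add_mem' ha hb g := by rw [map_add, ha g, hb g]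
  algebraMap_mem' r g := (linSubst (ρ g)).commutes r

theorem homogeneousComponent_mem_polyInvariants {ρ : G →* Matrix ι ι R} {p : MvPolynomial ι R}
    (hp : p ∈ polyInvariants ρ) (d : ℕ) : homogeneousComponent d p ∈ polyInvariants ρ := fun g => by
  rw [linSubst_homogeneousComponent, hp g]

variable [Fintype G]

/-- The averaging operator of a linear representation; `c` is meant to be the inverse of the order
of the group. -/
def reynolds (ρ : G →* Matrix ι ι R) (c : R) : MvPolynomial ι R →ₗ[R] MvPolynomial ι R :=
  c • ∑ g, (linSubst (ρ g)).toLinearMap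

theorem reynolds_apply (ρ : G →* Matrix ι ι R) (c : R) (p : MvPolynomial ι R) :
    reynolds ρ c p = c • ∑ g, linSubst (ρ g) p := by
  simp [reynolds, LinearMap.sum_apply]

theorem reynolds_mem (ρ : G →* Matrix ι ι R) (c : R) (p : MvPolynomial ι R) :
    reynolds ρ c p ∈ polyInvariants ρ := fun g => by
  rw [reynolds_apply, map_smul, map_sum, Finset.sum_congr rfl fun h _ => (linSubst_map_mul ρ g h p).symm,
    Fintype.sum_equiv (Equiv.mulLeft g) (fun h => linSubst (ρ (g * h)) p)
      (fun h => linSubst (ρ h) p) fun _ => rfl]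

theorem reynolds_mul_of_mem (ρ : G →* Matrix ι ι R) (c : R) (p : MvPolynomial ι R)
    {q : MvPolynomial ι R} (hq : q ∈ polyInvariants ρ) :
    reynolds ρ c (p * q) = reynolds ρ c p * q := by
  have h : ∀ g, linSubst (ρ g) (p * q) = linSubst (ρ g) p * q := fun g => by rw [map_mul, hq g]
  rw [reynolds_apply, reynolds_apply, Finset.sum_congr rfl fun g _ => h g, ← Finset.sum_mul,
    smul_mul_assoc]

theorem sub_reynolds (ρ : G →* Matrix ι ι R) {c : R} (hc : c * Fintype.card G = 1)
    (p : MvPolynomial ι R) :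
    p - reynolds ρ c p = c • ∑ g, (p - linSubst (ρ g) p) := by
  rw [reynolds_apply, Finset.sum_sub_distrib, smul_sub, Finset.sum_const, Finset.card_univ,
    ← Nat.cast_smul_eq_nsmul R, smul_smul, hc, one_smul]

theorem reynolds_of_mem (ρ : G →* Matrix ι ι R) {c : R} (hc : c * Fintype.card G = 1)
    {p : MvPolynomial ι R} (hp : p ∈ polyInvariants ρ) : reynolds ρ c p = p := by
  have h := sub_reynolds ρ hc p
  simp only [hp _, sub_self, Finset.sum_const_zero, smul_zero] at h
  exact (sub_eq_zero.1 h).symm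

theorem isHomogeneous_reynolds (ρ : G →* Matrix ι ι R) (c : R) {p : MvPolynomial ι R} {d : ℕ}
    (hp : p.IsHomogeneous d) : (reynolds ρ c p).IsHomogeneous d := by
  rw [reynolds_apply, smul_eq_C_mul]
  exact (IsHomogeneous.sum _ _ _ fun g _ => hp.linSubst (ρ g)).C_mul c

theorem isIntegral_polyInvariants (ρ : G →* Matrix ι ι R) :
    Algebra.IsIntegral (polyInvariants ρ) (MvPolynomial ι R) := by
  let _ : MulSemiringAction G (MvPolynomial ι R) :=
    { smul := fun g p => linSubst (ρ g) p
      one_smul := fun p => linSubst_map_one ρ p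
      mul_smul := fun g h p => linSubst_map_mul ρ g h p
      smul_zero := fun g => map_zero (linSubst (ρ g))
      smul_add := fun g => map_add (linSubst (ρ g))
      smul_one := fun g => map_one (linSubst (ρ g))
      smul_mul := fun g => map_mul (linSubst (ρ g)) }
  have : Algebra.IsInvariant (polyInvariants ρ) (MvPolynomial ι R) G :=
    ⟨fun b hb => ⟨⟨b, hb⟩, rfl⟩⟩
  exact Algebra.IsInvariant.isIntegral _ _ G

end Invariants

/-! ### The theorem of Chevalley, Shephard and Todd -/

section ChevalleyShephardTodd

variable {n m : ℕ} {k G : Type*} [Field k] [Group G] (ρ : G →* Matrix (Fin n) (Fin n) k)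

/-- The element `s` acts on linear forms by adding multiples of a fixed nonzero linear form. -/
def ActsAsReflection (s : G) : Prop :=
  ∃ L : MvPolynomial (Fin n) k, L ≠ 0 ∧ L.IsHomogeneous 1 ∧
    ∀ i, L ∣ linSubst (ρ s) (X i) - X i

variable {ρ}

theorem linSubst_mem_span_of_invariant {f : Fin m → MvPolynomial (Fin n) k}
    (hf : ∀ j, f j ∈ polyInvariants ρ) (g : G) {p : MvPolynomial (Fin n) k}
    (hp : p ∈ Ideal.span (Set.range f)) : linSubst (ρ g) p ∈ Ideal.span (Set.range f) := by
  obtain ⟨c, rfl⟩ := Ideal.mem_span_range_iff_exists_fun.1 hp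
  refine Ideal.mem_span_range_iff_exists_fun.2 ⟨fun j => linSubst (ρ g) (c j), ?_⟩
  simp_rw [map_sum, map_mul, hf _ g]

/-- Since `I` is stable under the group, the elements acting trivially on `p` modulo `I` form a
subgroup: `ghp - p = g(hp - p) + (gp - p)`. -/
theorem linSubst_sub_mem_of_closure (hgen : Subgroup.closure {s | ActsAsReflection ρ s} = ⊤)
    {I : Ideal (MvPolynomial (Fin n) k)} (hI : ∀ (g : G), ∀ p ∈ I, linSubst (ρ g) p ∈ I)
    {p : MvPolynomial (Fin n) k} (hp : ∀ s, ActsAsReflection ρ s → linSubst (ρ s) p - p ∈ I)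
    (g : G) : linSubst (ρ g) p - p ∈ I := by
  have hg : g ∈ Subgroup.closure {s | ActsAsReflection ρ s} := hgen ▸ Subgroup.mem_top g
  induction hg using Subgroup.closure_induction with
  | mem s hs => exact hp s hs
  | one => rw [linSubst_map_one, sub_self]; exact I.zero_mem
  | mul g h _ _ hg hh =>
    rw [linSubst_map_mul]
    have := I.add_mem (hI g _ hh) hg
    rwa [map_sub, sub_add_sub_cancel] at this
  | inv g _ hg =>
    have := I.neg_mem (hI g⁻¹ _ hg)
    rwa [map_sub, ← linSubst_map_mul, inv_mul_cancel, linSubst_map_one, neg_sub] at this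

/-- A finite system of homogeneous invariants of positive degree which generates the ideal generated by
all invariants without constant term. -/
def IsHilbertSystem (ρ : G →* Matrix (Fin n) (Fin n) k) (f : Fin m → MvPolynomial (Fin n) k) (d : Fin m → ℕ) : Prop :=
  (∀ j, f j ∈ polyInvariants ρ) ∧ (∀ j, (f j).IsHomogeneous (d j)) ∧ (∀ j, d j ≠ 0) ∧
    ∀ q ∈ polyInvariants ρ, constantCoeff q = 0 → q ∈ Ideal.span (Set.range f)

/-- The polynomial ring is Noetherian, and the homogeneous components of an invariant are invariant.
-/
theorem exists_isHilbertSystem (ρ : G →* Matrix (Fin n) (Fin n) k) : ∃ (m : ℕ) (f : Fin m → MvPolynomial (Fin n) k) (d : Fin m → ℕ),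
    IsHilbertSystem ρ f d := by
  let s : Set (MvPolynomial (Fin n) k) := {q | q ∈ polyInvariants ρ ∧ ∃ d ≠ 0, q.IsHomogeneous d}
  have hfg : (Ideal.span s).FG := IsNoetherian.noetherian _
  obtain ⟨t, hts, ht⟩ := (Submodule.fg_span_iff_fg_span_finset_subset s).1 hfg
  choose! d hd using fun q (hq : q ∈ s) => hq.2
  let f : Fin t.card → MvPolynomial (Fin n) k := fun j => (t.equivFin.symm j : _)
  have hfs : ∀ j, f j ∈ s := fun j => hts (t.equivFin.symm j).2
  have hrange : Set.range f = t := by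
    ext x
    constructor
    · rintro ⟨j, rfl⟩
      exact (t.equivFin.symm j).2
    · exact fun hx => ⟨t.equivFin ⟨x, hx⟩, by simp [f]⟩
  refine ⟨t.card, f, fun j => d (f j), fun j => (hfs j).1, fun j => (hd _ (hfs j)).2,
    fun j => (hd _ (hfs j)).1, fun q hq hq0 => ?_⟩
  rw [hrange]
  have h1 : q ∈ Ideal.span s := by
    rw [← sum_homogeneousComponent q]
    refine Ideal.sum_mem _ fun i _ => ?_
    rcases eq_or_ne i 0 with rfl | hi
    · rw [homogeneousComponent_zero, ← constantCoeff_eq, hq0, C_0]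
      exact Ideal.zero_mem _
    · exact Ideal.subset_span ⟨homogeneousComponent_mem_polyInvariants hq i, i, hi,
        homogeneousComponent_isHomogeneous i q⟩
  exact ht.le h1

/-- If `r j` had a nonzero constant term, the component of degree `d j` of the relation would
express `f j` by the other members, and `f j` could be dropped. -/
theorem IsHilbertSystem.constantCoeff_eq_zero_of_minimal {f : Fin m → MvPolynomial (Fin n) k}
    {d : Fin m → ℕ} (h : IsHilbertSystem ρ f d)
    (hmin : ∀ m' < m, ∀ (f' : Fin m' → MvPolynomial (Fin n) k) (d' : Fin m' → ℕ),
      ¬ IsHilbertSystem ρ f' d')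
    (r : Fin m → MvPolynomial (Fin n) k) (hr : ∑ j, r j * f j = 0) (j : Fin m) :
    constantCoeff (r j) = 0 := by
  obtain ⟨hf, hd, hd0, hspan⟩ := h
  obtain _ | m := m
  · exact j.elim0
  by_contra hc
  refine hmin m (Nat.lt_succ_self m) (f ∘ j.succAbove) (d ∘ j.succAbove)
    ⟨fun i => hf _, fun i => hd _, fun i => hd0 _, fun q hq hq0 => ?_⟩
  set J := Ideal.span (Set.range (f ∘ j.succAbove)) with hJ
  have hsub : ∀ i, f (j.succAbove i) ∈ J := fun i => Ideal.subset_span ⟨i, rfl⟩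
  have hfj : f j ∈ J := by
    rw [Fin.sum_univ_succAbove _ j] at hr
    have h1 := congrArg (homogeneousComponent (d j)) hr
    simp only [map_add, map_sum, map_zero, homogeneousComponent_mul_of_isHomogeneous (hd _),
      le_refl, if_true, Nat.sub_self, homogeneousComponent_zero] at h1
    rw [← constantCoeff_eq] at h1
    have h2 : C (constantCoeff (r j)) * f j ∈ J := by
      rw [eq_neg_of_add_eq_zero_left h1]
      exact J.neg_mem (J.sum_mem fun i _ => J.mul_mem_left _ (hsub i))
    have h3 := J.mul_mem_left (C (constantCoeff (r j))⁻¹) h2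
    rwa [← mul_assoc, ← C_mul, inv_mul_cancel₀ hc, C_1, one_mul] at h3
  refine Ideal.span_le.2 ?_ (hspan q hq hq0)
  rintro _ ⟨i, rfl⟩
  rcases Fin.eq_self_or_eq_succAbove j i with rfl | ⟨i', rfl⟩
  · exact hfj
  · exact hsub i'

variable [Fintype G]

/-- Chevalley's lemma, in the form: the syzygies of a minimal system of generators of the ideal generated
by the invariants of positive degree have coefficients in this ideal. -/
theorem syzygy_mem_span_invariants (hG : (Fintype.card G : k) ≠ 0)
    (hgen : Subgroup.closure {s | ActsAsReflection ρ s} = ⊤)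
    {f : Fin m → MvPolynomial (Fin n) k} (hf : ∀ j, f j ∈ polyInvariants ρ)
    (hspan : ∀ q ∈ polyInvariants ρ, constantCoeff q = 0 → q ∈ Ideal.span (Set.range f))
    (hmin : ∀ r : Fin m → MvPolynomial (Fin n) k, ∑ j, r j * f j = 0 → ∀ j, constantCoeff (r j) = 0)
    (r : Fin m → MvPolynomial (Fin n) k) (hr : ∑ j, r j * f j = 0) (j : Fin m) :
    r j ∈ Ideal.span (Set.range f) := by
  -- Induction on a strict bound for the degrees of the coefficients. Zero is listed apart because
  -- its `totalDegree` is `0`, so that the bound `N = 0` leaves only the zero syzygy.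
  suffices H : ∀ N, ∀ r : Fin m → MvPolynomial (Fin n) k, (∀ j, r j = 0 ∨ (r j).totalDegree < N) →
      ∑ j, r j * f j = 0 → ∀ j, r j ∈ Ideal.span (Set.range f) from
    H (∑ i, (r i).totalDegree + 1) r (fun i => Or.inr <| Nat.lt_succ_of_le
      (Finset.single_le_sum (f := fun i => (r i).totalDegree) (fun _ _ => Nat.zero_le _)
        (Finset.mem_univ i))) hr j
  intro N
  induction N with
  | zero =>
    intro r h _ j
    rw [(h j).resolve_right (Nat.not_lt_zero _)]
    exact Ideal.zero_mem _
  | succ N ih =>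
    intro r hdeg hr j
    have hc : (Fintype.card G : k)⁻¹ * Fintype.card G = 1 := inv_mul_cancel₀ hG
    have hrefl : ∀ s, ActsAsReflection ρ s → ∀ j, linSubst (ρ s) (r j) - r j ∈
        Ideal.span (Set.range f) := by
      rintro s ⟨L, hL0, hL1, hL⟩
      -- The quotients of `s (r j) - r j` by `L` form a syzygy again, as the `f j` are invariant and
      -- `L` cancels; their degrees are smaller by one.
      choose r' hr' using fun j => dvd_linSubst_sub hL (r j)
      have hmem := ih r' (fun j => ?_) ?_
      · exact fun j => hr' j ▸ Ideal.mul_mem_left _ _ (hmem j)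
      · refine or_iff_not_imp_left.2 fun h0 => ?_
        have h1 := totalDegree_mul_of_isDomain hL0 h0
        rw [hL1.totalDegree hL0, ← hr' j] at h1
        have h2 := (totalDegree_sub (linSubst (ρ s) (r j)) (r j)).trans
          (max_le (totalDegree_linSubst_le _ _) le_rfl)
        rcases hdeg j with h3 | h3
        · have h4 := hr' j
          rw [h3, map_zero, sub_zero] at h4
          exact absurd h4.symm (mul_ne_zero hL0 h0)
        · omega
      · have h1 : L * ∑ j, r' j * f j = 0 := by
          have h2 : ∀ j, L * (r' j * f j) = linSubst (ρ s) (r j * f j) - r j * f j := fun j => by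
            rw [← mul_assoc, ← hr' j, map_mul, hf j s, sub_mul]
          rw [Finset.mul_sum, Finset.sum_congr rfl fun j _ => h2 j, Finset.sum_sub_distrib,
            ← map_sum, hr, map_zero, sub_zero]
        exact (mul_eq_zero.1 h1).resolve_left hL0
    -- Being invariant modulo the ideal, `r j` is congruent to its average. The averages form a
    -- syzygy of invariants, which by `hmin` have no constant term, so they lie in the ideal.
    have h1 : r j - reynolds ρ (Fintype.card G : k)⁻¹ (r j) ∈ Ideal.span (Set.range f) := by
      rw [sub_reynolds ρ hc, smul_eq_C_mul]
      refine Ideal.mul_mem_left _ _ (Ideal.sum_mem _ fun g _ => ?_)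
      rw [← neg_sub]
      exact Submodule.neg_mem _ (linSubst_sub_mem_of_closure hgen
        (fun g p => linSubst_mem_span_of_invariant hf g) (fun s hs => hrefl s hs j) g)
    have h2 : ∑ j, reynolds ρ (Fintype.card G : k)⁻¹ (r j) * f j = 0 := by
      rw [← map_zero (reynolds ρ (Fintype.card G : k)⁻¹), ← hr, map_sum]
      exact Finset.sum_congr rfl fun j _ => (reynolds_mul_of_mem ρ _ _ (hf j)).symm
    have h3 := hspan _ (reynolds_mem ρ (Fintype.card G : k)⁻¹ (r j)) (hmin _ h2 j)
    simpa using Ideal.add_mem _ h1 h3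

/-- Hilbert's argument: in `q = ∑ r j * f j` the coefficients may be replaced by averages of their
components of degree `e - d j`, which are invariants of lower degree. -/
theorem mem_adjoin_of_span_invariants (hG : (Fintype.card G : k) ≠ 0)
    {f : Fin m → MvPolynomial (Fin n) k} {d : Fin m → ℕ} (hf : ∀ j, f j ∈ polyInvariants ρ)
    (hd : ∀ j, (f j).IsHomogeneous (d j)) (hd0 : ∀ j, d j ≠ 0)
    (hspan : ∀ q ∈ polyInvariants ρ, constantCoeff q = 0 → q ∈ Ideal.span (Set.range f)) :
    Algebra.adjoin k (Set.range f) = polyInvariants ρ := by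
  refine le_antisymm (Algebra.adjoin_le (by rintro _ ⟨j, rfl⟩; exact hf j)) ?_
  have hc : (Fintype.card G : k)⁻¹ * Fintype.card G = 1 := inv_mul_cancel₀ hG
  have key : ∀ e, ∀ q ∈ polyInvariants ρ, q.IsHomogeneous e →
      q ∈ Algebra.adjoin k (Set.range f) := by
    intro e
    induction e using Nat.strong_induction_on with
    | _ e ih =>
    intro q hq hqe
    rcases eq_or_ne e 0 with rfl | he
    · rw [← totalDegree_zero_iff_isHomogeneous, totalDegree_eq_zero_iff_eq_C] at hqe
      rw [hqe]
      exact Subalgebra.algebraMap_mem _ _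
    obtain ⟨r, hr⟩ := Ideal.mem_span_range_iff_exists_fun.1
      (hspan q hq (hqe.constantCoeff_eq_zero he))
    have h1 : q = ∑ j, reynolds ρ (Fintype.card G : k)⁻¹
        (if d j ≤ e then homogeneousComponent (e - d j) (r j) else 0) * f j := by
      rw [← reynolds_of_mem ρ hc hq, ← homogeneousComponent_eq_self hqe, ← hr, map_sum, map_sum]
      refine Finset.sum_congr rfl fun j _ => ?_
      rw [homogeneousComponent_mul_of_isHomogeneous (hd j), reynolds_mul_of_mem ρ _ _ (hf j)]
    rw [h1]
    refine Subalgebra.sum_mem _ fun j _ => Subalgebra.mul_mem _ ?_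
      (Algebra.subset_adjoin (Set.mem_range_self j))
    split_ifs with hj
    · exact ih (e - d j) (by have := hd0 j; omega) _ (reynolds_mem _ _ _)
        (isHomogeneous_reynolds _ _ (homogeneousComponent_isHomogeneous _ _))
    · rw [map_zero]
      exact Subalgebra.zero_mem _
  intro q hq
  rw [← sum_homogeneousComponent q]
  exact Subalgebra.sum_mem _ fun i _ => key i _ (homogeneousComponent_mem_polyInvariants hq i)
    (homogeneousComponent_isHomogeneous i q)

/-- The theorem of Chevalley, Shephard and Todd, in the case where the order of the group is invertible. -/
theorem exists_algebraicIndependent_generators (hG : (Fintype.card G : k) ≠ 0)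
    (hgen : Subgroup.closure {s | ActsAsReflection ρ s} = ⊤) :
    ∃ (f : Fin n → MvPolynomial (Fin n) k) (d : Fin n → ℕ), AlgebraicIndependent k f ∧
      Algebra.adjoin k (Set.range f) = polyInvariants ρ ∧ ∀ i, (f i).IsHomogeneous (d i) := by
  classical
  let P : ℕ → Prop := fun m => ∃ (f : Fin m → MvPolynomial (Fin n) k) (d : Fin m → ℕ),
    IsHilbertSystem ρ f d
  have hP : ∃ m, P m := exists_isHilbertSystem ρ
  obtain ⟨m, ⟨f, d, hfd⟩, hmin⟩ : ∃ m, P m ∧ ∀ m' < m, ¬ P m' :=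
    ⟨Nat.find hP, Nat.find_spec hP, fun m' hm' => Nat.find_min hP hm'⟩
  obtain ⟨hf, hd, hd0, hspan⟩ := hfd
  have hmn : m ≤ n := card_le_of_syzygies_mem f X
    (fun j => mem_span_range_X_of_constantCoeff_eq_zero ((hd j).constantCoeff_eq_zero (hd0 j)))
    span_range_X_ne_top
    (syzygy_mem_span_invariants hG hgen hf hspan
      (IsHilbertSystem.constantCoeff_eq_zero_of_minimal ⟨hf, hd, hd0, hspan⟩
        fun m' hm' f' d' h => hmin m' hm' ⟨f', d', h⟩))
  have hadj := mem_adjoin_of_span_invariants hG hf hd hd0 hspan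
  have := isIntegral_polyInvariants ρ
  -- At most `n` elements over which a ring of transcendence degree `n` is algebraic must form a
  -- transcendence basis, whence `m = n`.
  have : Algebra.IsAlgebraic (Algebra.adjoin k (Set.range f)) (MvPolynomial (Fin n) k) := by
    rw [hadj]
    infer_instance
  have htr : IsTranscendenceBasis k f :=
    Algebra.IsAlgebraic.isTranscendenceBasis_of_lift_le_trdeg_of_finite k f (by simpa using hmn)
  obtain rfl : m = n := by simpa using htr.lift_cardinalMk_eq_trdeg
  exact ⟨f, d, htr.1, hadj, hd⟩

end ChevalleyShephardTodd

end MvPolynomial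

/-! ### Degrees and Hilbert series -/

/-- Let `m` be the largest exponent on either side. A primitive `m`-th root of unity is a zero of
both products, which forces an exponent divisible by `m`, hence equal to `m`, on the other side.
Cancel this factor and repeat. -/
theorem Multiset.eq_of_prod_one_sub_X_pow_eq : ∀ s t : Multiset ℕ, (∀ d ∈ s, d ≠ 0) → (∀ d ∈ t, d ≠ 0) →
    (s.map fun d => (1 - Polynomial.X ^ d : Polynomial ℂ)).prod =
      (t.map fun d => (1 - Polynomial.X ^ d : Polynomial ℂ)).prod → s = t := by
  have root : ∀ (t : Multiset ℕ) (z : ℂ),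
      ((t.map fun d => (1 - Polynomial.X ^ d : Polynomial ℂ)).prod).eval z = 0 ↔
        ∃ e ∈ t, z ^ e = 1 := by
    intro t z
    rw [← Polynomial.coe_evalRingHom, map_multiset_prod, Multiset.prod_eq_zero_iff]
    simp [sub_eq_zero, eq_comm (a := (1 : ℂ))]
  have mem : ∀ s t : Multiset ℕ, (∀ d ∈ t, d ≠ 0) → ∀ m ∈ s, m ≠ 0 → (∀ e ∈ t, e ≤ m) →
      (s.map fun d => (1 - Polynomial.X ^ d : Polynomial ℂ)).prod =
        (t.map fun d => (1 - Polynomial.X ^ d : Polynomial ℂ)).prod → m ∈ t := by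
    intro s t ht m hm hm0 hmax h
    have hz := Complex.isPrimitiveRoot_exp m hm0
    have h1 := (root s _).2 ⟨m, hm, hz.pow_eq_one⟩
    rw [h, root] at h1
    obtain ⟨e, he, hze⟩ := h1
    have := Nat.le_of_dvd (Nat.pos_of_ne_zero (ht e he)) ((hz.pow_eq_one_iff_dvd e).1 hze)
    rwa [le_antisymm this (hmax e he)]
  suffices H : ∀ N, ∀ s t : Multiset ℕ, s.card = N → (∀ d ∈ s, d ≠ 0) → (∀ d ∈ t, d ≠ 0) →
      (s.map fun d => (1 - Polynomial.X ^ d : Polynomial ℂ)).prod =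
        (t.map fun d => (1 - Polynomial.X ^ d : Polynomial ℂ)).prod → s = t from
    fun s t => H _ s t rfl
  intro N
  induction N with
  | zero =>
    intro s t hs _ _ h
    rw [Multiset.card_eq_zero] at hs
    subst hs
    refine (Multiset.eq_zero_of_forall_notMem fun e he => ?_).symm
    have := (root t 1).2 ⟨e, he, one_pow e⟩
    rw [← h] at this
    simp at this
  | succ N ih =>
    intro s t hs hs0 ht0 h
    obtain ⟨x, hx⟩ : ∃ x, x ∈ s := Multiset.card_pos_iff_exists_mem.1 (by omega)
    obtain ⟨m, hm, hmax⟩ := Finset.exists_max_image (s + t).toFinset id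
      ⟨x, by simp [hx]⟩
    simp only [Multiset.mem_toFinset, Multiset.mem_add, id] at hm hmax
    have hm0 : m ≠ 0 := hm.elim (hs0 m) (ht0 m)
    have hms : m ∈ s := hm.elim id fun hmt =>
      mem t s hs0 m hmt hm0 (fun e he => hmax e (Or.inl he)) h.symm
    have hmt : m ∈ t := mem s t ht0 m hms hm0 (fun e he => hmax e (Or.inr he)) h
    obtain ⟨s, rfl⟩ := Multiset.exists_cons_of_mem hms
    obtain ⟨t, rfl⟩ := Multiset.exists_cons_of_mem hmt
    rw [Multiset.card_cons, Nat.succ_inj] at hs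
    simp only [Multiset.map_cons, Multiset.prod_cons] at h
    have hne : (1 - Polynomial.X ^ m : Polynomial ℂ) ≠ 0 := fun h0 => by
      have := congrArg (Polynomial.eval 0) h0
      simp [hm0] at this
    rw [ih s t hs (fun d hd => hs0 d (Multiset.mem_cons_of_mem hd))
      (fun d hd => ht0 d (Multiset.mem_cons_of_mem hd)) (mul_left_cancel₀ hne h)]

/-- The number of monomials of weight `m` in variables of weights `d i`. -/
def weightCount {n : ℕ} (d : Fin n → ℕ) (m : ℕ) : ℕ :=
  Nat.card {a : Fin n →₀ ℕ // ∑ i, a i * d i = m}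

/-- The counting series is the product of the geometric series `∑ X ^ (a * d i)`, each inverse to `1
- X ^ d i`. Positive weights are needed for these inverses to exist. -/
theorem mk_weightCount_mul_prod {n : ℕ} {d : Fin n → ℕ} (hd : ∀ i, d i ≠ 0) :
    PowerSeries.mk (fun m => (weightCount d m : ℂ)) * ∏ i, (1 - PowerSeries.X ^ d i) = 1 := by
  classical
  have h1 : ∀ e : ℕ, e ≠ 0 → PowerSeries.mk (fun m => if e ∣ m then (1 : ℂ) else 0) *
      (1 - PowerSeries.X ^ e) = 1 := by
    intro e he
    ext m
    rw [mul_sub, mul_one, map_sub, PowerSeries.coeff_mul_X_pow', PowerSeries.coeff_one]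
    simp only [PowerSeries.coeff_mk]
    rcases eq_or_ne m 0 with rfl | hm
    · simp [he]
    · by_cases hem : e ≤ m
      · have : e ∣ m - e ↔ e ∣ m := by
          obtain ⟨l, rfl⟩ := Nat.exists_eq_add_of_le hem
          rw [Nat.add_sub_cancel_left, Nat.dvd_add_self_left]
        simp only [hem, hm, this, if_true, if_false, sub_self]
      · simp [hem, hm, Nat.not_dvd_of_pos_of_lt (Nat.pos_of_ne_zero hm) (not_le.1 hem)]
  have h2 : PowerSeries.mk (fun m => (weightCount d m : ℂ)) =
      ∏ i, PowerSeries.mk (fun m => if d i ∣ m then (1 : ℂ) else 0) := by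
    ext m
    rw [PowerSeries.coeff_prod]
    simp only [PowerSeries.coeff_mk, Finset.prod_boole, Finset.mem_univ, true_imp_iff]
    rw [Finset.sum_boole, weightCount, Nat.cast_inj, ← Fintype.card_coe, ← Nat.card_eq_fintype_card]
    refine Nat.card_congr
      { toFun := fun a => ⟨Finsupp.equivFunOnFinite.symm fun i => a.1 i * d i, by
          simp [Finset.mem_finsuppAntidiag, a.2]⟩
        invFun := fun l => ⟨Finsupp.equivFunOnFinite.symm fun i => l.1 i / d i, by
          have hl := Finset.mem_filter.1 l.2
          rw [Finset.mem_finsuppAntidiag] at hl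
          refine Eq.trans ?_ hl.1.1
          exact Finset.sum_congr rfl fun i _ => Nat.div_mul_cancel (hl.2 i)⟩
        left_inv := fun a => Subtype.ext <| Finsupp.ext fun i =>
          Nat.mul_div_cancel _ (Nat.pos_of_ne_zero (hd i))
        right_inv := fun l => Subtype.ext <| Finsupp.ext fun i =>
          Nat.div_mul_cancel ((Finset.mem_filter.1 l.2).2 i) }
  rw [h2, ← Finset.prod_mul_distrib]
  exact Finset.prod_eq_one fun i _ => h1 _ (hd i)

theorem eq_of_weightCount_eq {n n' : ℕ} {d : Fin n → ℕ} {d' : Fin n' → ℕ} (hd : ∀ i, d i ≠ 0)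
    (hd' : ∀ i, d' i ≠ 0) (h : ∀ m, weightCount d m = weightCount d' m) :
    Finset.univ.val.map d = Finset.univ.val.map d' := by
  have h1 := mk_weightCount_mul_prod hd
  have h2 := mk_weightCount_mul_prod hd'
  simp_rw [← h] at h2
  have h3 := mul_left_cancel₀ (left_ne_zero_of_mul_eq_one h1) (h1.trans h2.symm)
  refine Multiset.eq_of_prod_one_sub_X_pow_eq _ _ (by simpa using hd) (by simpa using hd') ?_
  rw [Multiset.map_map, Multiset.map_map]
  change ∏ i, (1 - Polynomial.X ^ d i : Polynomial ℂ) = ∏ i, (1 - Polynomial.X ^ d' i)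
  apply Polynomial.coe_injective
  rw [← Polynomial.coeToPowerSeries.ringHom_apply, ← Polynomial.coeToPowerSeries.ringHom_apply]
  simpa [map_prod] using h3

namespace MvPolynomial

/-- The monomials of weight `m` in the `f i` form a basis: independent by algebraic independence,
spanning because the component of degree `m` discards all other monomials. -/
theorem finrank_adjoin_inf_homogeneousSubmodule {σ k : Type*} [Field k] {n : ℕ}
    {f : Fin n → MvPolynomial σ k} {d : Fin n → ℕ} (hf : AlgebraicIndependent k f)
    (hd : ∀ i, (f i).IsHomogeneous (d i)) (m : ℕ) :
    Module.finrank k ↥(Subalgebra.toSubmodule (Algebra.adjoin k (Set.range f)) ⊓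
      homogeneousSubmodule σ k m) = weightCount d m := by
  obtain ⟨v, hvdef⟩ : ∃ v : {a : Fin n →₀ ℕ // ∑ i, a i * d i = m} → MvPolynomial σ k,
      ∀ a, v a = aeval f (monomial a.1 (1 : k)) := ⟨_, fun _ => rfl⟩
  have hhom : ∀ a : Fin n →₀ ℕ, (aeval f (monomial a (1 : k))).IsHomogeneous (∑ i, a i * d i) := by
    intro a
    rw [aeval_monomial, map_one, one_mul, Finsupp.prod_fintype _ _ (by simp)]
    refine IsHomogeneous.prod _ _ _ fun i _ => ?_
    rw [mul_comm]
    exact (hd i).pow _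
  have hv : LinearIndependent k v := by
    have h1 := (basisMonomials (Fin n) k).linearIndependent.comp
      (Subtype.val : {a : Fin n →₀ ℕ // ∑ i, a i * d i = m} → _) Subtype.val_injective
    have h2 := h1.map' (aeval f).toLinearMap (LinearMap.ker_eq_bot.2 hf)
    have h3 : v = (aeval f).toLinearMap ∘ basisMonomials (Fin n) k ∘ Subtype.val :=
      _root_.funext fun a => by
        rw [hvdef, Function.comp_apply, Function.comp_apply, coe_basisMonomials,
          AlgHom.toLinearMap_apply]
    rw [h3]
    exact h2
  have hspan : Subalgebra.toSubmodule (Algebra.adjoin k (Set.range f)) ⊓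
      homogeneousSubmodule σ k m = Submodule.span k (Set.range v) := by
    apply le_antisymm
    · rintro p ⟨hp, hpm⟩
      rw [SetLike.mem_coe, Subalgebra.mem_toSubmodule, Algebra.adjoin_range_eq_range_aeval] at hp
      obtain ⟨P, rfl⟩ := hp
      rw [SetLike.mem_coe, mem_homogeneousSubmodule] at hpm
      simp only [AlgHom.toRingHom_eq_coe, RingHom.coe_coe] at hpm ⊢
      rw [← homogeneousComponent_eq_self hpm, P.as_sum, map_sum, map_sum]
      refine Submodule.sum_mem _ fun a _ => ?_
      rw [← mul_one (coeff a P), ← smul_eq_mul, ← smul_monomial, map_smul, map_smul]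
      refine Submodule.smul_mem _ _ ?_
      rw [homogeneousComponent_of_mem (hhom a)]
      split_ifs with h
      · exact Submodule.subset_span ⟨⟨a, h.symm⟩, hvdef _⟩
      · exact Submodule.zero_mem _
    · rw [Submodule.span_le]
      rintro _ ⟨a, rfl⟩
      rw [hvdef]
      refine ⟨?_, ?_⟩
      · rw [SetLike.mem_coe, Subalgebra.mem_toSubmodule, Algebra.adjoin_range_eq_range_aeval]
        exact AlgHom.mem_range_self _ _
      · have := hhom a.1
        rw [a.2] at this
        exact this
  rw [hspan, weightCount]
  exact Module.finrank_eq_nat_card_basis (Module.Basis.span hv)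

theorem ne_zero_of_algebraicIndependent {σ k ι : Type*} [Field k] {f : ι → MvPolynomial σ k}
    {d : ι → ℕ} (hf : AlgebraicIndependent k f) (hd : ∀ i, (f i).IsHomogeneous (d i)) (i : ι) :
    d i ≠ 0 := by
  intro h
  have h1 := hd i
  rw [h, ← totalDegree_zero_iff_isHomogeneous, totalDegree_eq_zero_iff_eq_C] at h1
  refine hf.transcendental i ?_
  rw [h1]
  exact isAlgebraic_algebraMap _

end MvPolynomial

/-! ### Ranks of invariants under change of the base ring -/

theorem Submodule.finrank_add_finrank_of_inf_eq_bot {R N : Type*} [CommRing R] [IsDomain R]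
    [AddCommGroup N] [Module R N] {P Q W : Submodule R N} [Module.Finite R P] [Module.Finite R Q]
    (h1 : P ⊓ Q = ⊥) (h2 : P ⊔ Q = W) :
    Module.finrank R P + Module.finrank R Q = Module.finrank R W := by
  have h := Submodule.rank_sup_add_rank_inf_eq P Q
  rw [h1, h2, rank_bot, add_zero] at h
  have hW : Module.Finite R W := h2 ▸ Submodule.finite_sup P Q
  rw [← Module.finrank_eq_rank, ← Module.finrank_eq_rank, ← Module.finrank_eq_rank] at h
  exact_mod_cast h.symm

namespace MvPolynomial

theorem finrank_homogeneousSubmodule {σ R : Type*} [CommRing R] [Nontrivial R] (m : ℕ) :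
    Module.finrank R (homogeneousSubmodule σ R m) = Nat.card {a : σ →₀ ℕ // a.degree = m} := by
  have h1 : homogeneousSubmodule σ R m = Submodule.span R
      (Set.range fun a : {a : σ →₀ ℕ // a.degree = m} => monomial a.1 (1 : R)) := by
    apply le_antisymm
    · intro p hp
      rw [mem_homogeneousSubmodule] at hp
      rw [p.as_sum]
      refine Submodule.sum_mem _ fun a ha => ?_
      rw [← mul_one (coeff a p), ← smul_eq_mul, ← smul_monomial]
      refine Submodule.smul_mem _ _ (Submodule.subset_span ⟨⟨a, ?_⟩, rfl⟩)
      by_contra h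
      exact (mem_support_iff.1 ha) (hp.coeff_eq_zero h)
    · rw [Submodule.span_le]
      rintro _ ⟨a, rfl⟩
      exact isHomogeneous_monomial _ a.2
  have h2 : LinearIndependent R
      (fun a : {a : σ →₀ ℕ // a.degree = m} => monomial a.1 (1 : R)) := by
    have := (basisMonomials σ R).linearIndependent.comp
      (Subtype.val : {a : σ →₀ ℕ // a.degree = m} → _) Subtype.val_injective
    rwa [coe_basisMonomials] at this
  rw [h1]
  exact Module.finrank_eq_nat_card_basis (Module.Basis.span h2)

section BaseChange

variable {σ T k : Type*} [CommRing T] [IsDomain T] [IsPrincipalIdealRing T] [Field k] [Finite σ]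

theorem finite_of_le_homogeneousSubmodule {m : ℕ} {P : Submodule T (MvPolynomial σ T)}
    (hP : P ≤ homogeneousSubmodule σ T m) : Module.Finite T P := by
  have : Module.Finite T (homogeneousSubmodule σ T m) :=
    Module.Finite.iff_fg.2 (homogeneousSubmodule_fg _ _ m)
  exact Module.Finite.of_injective (Submodule.inclusion hP) (Submodule.inclusion_injective hP)

/-- Since `E'` fixes `P'`, this space lies in the span of the `E'` of monomials. These are
reductions of elements of `P`, so the reduction of a basis of `P` spans a space containing `P'`. -/
theorem finrank_le_of_projection (φ : T →+* k) {m : ℕ}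
    (E : MvPolynomial σ T →ₗ[T] MvPolynomial σ T) (E' : MvPolynomial σ k →ₗ[k] MvPolynomial σ k)
    (hE : ∀ p, map φ (E p) = E' (map φ p))
    {P : Submodule T (MvPolynomial σ T)} (hP : P ≤ homogeneousSubmodule σ T m)
    (hEP : ∀ p ∈ homogeneousSubmodule σ T m, E p ∈ P)
    {P' : Submodule k (MvPolynomial σ k)} (hP' : P' ≤ homogeneousSubmodule σ k m)
    (hEP' : ∀ p ∈ P', E' p = p) : Module.finrank k P' ≤ Module.finrank T P := by
  have := finite_of_le_homogeneousSubmodule hP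
  let b := Module.finBasis T P
  have h1 : P' ≤ Submodule.span k (Set.range fun i => map φ (b i : MvPolynomial σ T)) := by
    intro p hp
    have hpm := hP' hp
    rw [mem_homogeneousSubmodule] at hpm
    rw [← hEP' p hp, p.as_sum, map_sum]
    refine Submodule.sum_mem _ fun a ha => ?_
    rw [← mul_one (coeff a p), ← smul_eq_mul, ← smul_monomial, map_smul, ← map_one φ,
      ← map_monomial, ← hE]
    have h2 : E (monomial a 1) ∈ P := hEP _ (isHomogeneous_monomial _ (by
      by_contra h
      exact (mem_support_iff.1 ha) (hpm.coeff_eq_zero h)))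
    have h3 := congrArg (Subtype.val : P → _) (b.sum_repr ⟨_, h2⟩)
    change _ = E (monomial a 1) at h3
    rw [← h3]
    simp only [Submodule.coe_sum, Submodule.coe_smul, map_sum, smul_eq_C_mul, map_mul, map_C]
    simp only [← smul_eq_C_mul]
    exact Submodule.smul_mem _ _ (Submodule.sum_mem _ fun i _ => Submodule.smul_mem _ _
      (Submodule.subset_span ⟨i, rfl⟩))
  have h2 : Module.Finite k (Submodule.span k (Set.range fun i => map φ (b i : MvPolynomial σ T))) :=
    Module.Finite.span_of_finite k (Set.finite_range _)
  exact (Submodule.finrank_mono h1).trans ((finrank_range_le_card _).trans (by simp))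

end BaseChange

section InvariantsBaseChange

variable {ι G : Type*} [Fintype ι] [DecidableEq ι] [Group G]

/-- Extension of scalars of a matrix representation. -/
def mapRepresentation {T k : Type*} [CommRing T] [CommRing k] (φ : T →+* k)
    (ρ : G →* Matrix ι ι T) : G →* Matrix ι ι k :=
  (φ.mapMatrix : Matrix ι ι T →+* Matrix ι ι k).toMonoidHom.comp ρ

theorem mapRepresentation_apply {T k : Type*} [CommRing T] [CommRing k] (φ : T →+* k)
    (ρ : G →* Matrix ι ι T) (g : G) : mapRepresentation φ ρ g = (ρ g).map φ := rfl

variable [Fintype G]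

theorem finrank_polyInvariants_add_finrank_ker {R : Type*} [CommRing R] [IsDomain R]
    [IsPrincipalIdealRing R] (ρ : G →* Matrix ι ι R) {c : R} (hc : c * Fintype.card G = 1) (m : ℕ) :
    Module.finrank R ↥(Subalgebra.toSubmodule (polyInvariants ρ) ⊓ homogeneousSubmodule ι R m) +
      Module.finrank R ↥(LinearMap.ker (reynolds ρ c) ⊓ homogeneousSubmodule ι R m) =
    Nat.card {a : ι →₀ ℕ // a.degree = m} := by
  set P := Subalgebra.toSubmodule (polyInvariants ρ) ⊓ homogeneousSubmodule ι R m with hP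
  set Q := LinearMap.ker (reynolds ρ c) ⊓ homogeneousSubmodule ι R m with hQ
  have : Module.Finite R P := finite_of_le_homogeneousSubmodule inf_le_right
  have : Module.Finite R Q := finite_of_le_homogeneousSubmodule inf_le_right
  rw [← finrank_homogeneousSubmodule (R := R)]
  have h1 : P ⊓ Q = ⊥ := by
    rw [eq_bot_iff]
    rintro p ⟨hp, hp'⟩
    have h2 : reynolds ρ c p = 0 := hp'.1
    rw [reynolds_of_mem ρ hc hp.1] at h2
    exact h2
  have h2 : P ⊔ Q = homogeneousSubmodule ι R m := by
    refine le_antisymm (sup_le inf_le_right inf_le_right) fun p hp => ?_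
    have hR := isHomogeneous_reynolds ρ c hp
    refine Submodule.mem_sup.2 ⟨reynolds ρ c p, ⟨reynolds_mem ρ c p, hR⟩, p - reynolds ρ c p,
      ⟨?_, Submodule.sub_mem _ hp hR⟩, by simp⟩
    rw [SetLike.mem_coe, LinearMap.mem_ker, map_sub, reynolds_of_mem ρ hc (reynolds_mem ρ c p),
      sub_self]
  exact Submodule.finrank_add_finrank_of_inf_eq_bot h1 h2

/-- The averaging projection and its complement each give an inequality of ranks. The sum of the two
ranks is the number of monomials of degree `m` over either ring, so both are equalities. The map `φ`
may be a reduction or an embedding. -/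
theorem finrank_polyInvariants_map {T k : Type*} [CommRing T] [IsDomain T] [IsPrincipalIdealRing T]
    [Field k] (φ : T →+* k) (ρ : G →* Matrix ι ι T) (hG : IsUnit (Fintype.card G : T)) (m : ℕ) :
    Module.finrank k ↥(Subalgebra.toSubmodule
        (polyInvariants (mapRepresentation φ ρ)) ⊓
          homogeneousSubmodule ι k m) =
      Module.finrank T ↥(Subalgebra.toSubmodule (polyInvariants ρ) ⊓
        homogeneousSubmodule ι T m) := by
  set ρ' := mapRepresentation φ ρ with hρ'
  obtain ⟨c, hc⟩ := hG.exists_left_inv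
  have hc' : φ c * Fintype.card G = 1 := by
    rw [← map_natCast φ, ← map_mul, hc, map_one]
  have hmap : ∀ p, map φ (reynolds ρ c p) = reynolds ρ' (φ c) (map φ p) := by
    intro p
    simp only [reynolds_apply, smul_eq_C_mul, map_mul, map_C, map_sum, map_linSubst]
    rfl
  have h1 : Module.finrank k ↥(Subalgebra.toSubmodule (polyInvariants ρ') ⊓
      homogeneousSubmodule ι k m) ≤ Module.finrank T ↥(Subalgebra.toSubmodule (polyInvariants ρ) ⊓
        homogeneousSubmodule ι T m) :=
    finrank_le_of_projection φ (reynolds ρ c) (reynolds ρ' (φ c)) hmap inf_le_right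
      (fun p hp => ⟨reynolds_mem ρ c p, isHomogeneous_reynolds ρ c hp⟩) inf_le_right
      (fun p hp => reynolds_of_mem ρ' hc' hp.1)
  have h2 : Module.finrank k ↥(LinearMap.ker (reynolds ρ' (φ c)) ⊓ homogeneousSubmodule ι k m) ≤
      Module.finrank T ↥(LinearMap.ker (reynolds ρ c) ⊓ homogeneousSubmodule ι T m) := by
    refine finrank_le_of_projection φ (LinearMap.id - reynolds ρ c)
      (LinearMap.id - reynolds ρ' (φ c)) (fun p => ?_) inf_le_right (fun p hp => ⟨?_, ?_⟩)
      inf_le_right (fun p hp => ?_)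
    · simp [hmap]
    · rw [SetLike.mem_coe, LinearMap.mem_ker, LinearMap.sub_apply, LinearMap.id_apply, map_sub,
        reynolds_of_mem ρ hc (reynolds_mem ρ c p), sub_self]
    · exact Submodule.sub_mem _ hp (isHomogeneous_reynolds ρ c hp)
    · have h3 : reynolds ρ' (φ c) p = 0 := hp.1
      rw [LinearMap.sub_apply, LinearMap.id_apply, h3, sub_zero]
  have h3 := finrank_polyInvariants_add_finrank_ker ρ hc m
  have h4 := finrank_polyInvariants_add_finrank_ker ρ' hc' m
  omega

end InvariantsBaseChange

end MvPolynomial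

/-! ### From the symmetric algebra to polynomials -/

theorem SymmetricAlgebra.equivMvPolynomial_ι_eq_sum {ι k V : Type*} [Fintype ι] [CommRing k]
    [AddCommGroup V] [Module k V] (b : Module.Basis ι k V) (v : V) :
    equivMvPolynomial b (SymmetricAlgebra.ι k V v) = ∑ j, C (b.repr v j) * X j := by
  conv_lhs => rw [← b.sum_repr v]
  rw [map_sum, map_sum]
  refine Finset.sum_congr rfl fun j _ => ?_
  rw [map_smul, map_smul, equivMvPolynomial_ι_apply, smul_eq_C_mul]

theorem SymmetricAlgebra.mem_range_ι_pow_iff {ι k V : Type*} [Fintype ι] [CommRing k]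
    [AddCommGroup V] [Module k V] (b : Module.Basis ι k V) (f : SymmetricAlgebra k V) (m : ℕ) :
    f ∈ LinearMap.range (SymmetricAlgebra.ι k V) ^ m ↔ (equivMvPolynomial b f).IsHomogeneous m := by
  have h1 : (LinearMap.range (SymmetricAlgebra.ι k V)).map
      (equivMvPolynomial b).toAlgHom.toLinearMap = homogeneousSubmodule ι k 1 := by
    rw [LinearMap.range_eq_map, ← b.span_eq, Submodule.map_span, Submodule.map_span,
      homogeneousSubmodule_one_eq_span_X, ← Set.range_comp, ← Set.range_comp]
    congr 2
    ext1 i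
    exact equivMvPolynomial_ι_apply b i
  rw [← mem_homogeneousSubmodule, ← homogeneousSubmodule_one_pow, ← h1, ← Submodule.map_pow]
  constructor
  · exact fun h => ⟨f, h, rfl⟩
  · rintro ⟨f', hf', h⟩
    rwa [← (equivMvPolynomial b).injective h]

namespace ArrangementData

section

variable {ι k V : Type*} [Fintype ι] [DecidableEq ι] [CommRing k] [AddCommGroup V] [Module k V]

theorem equivMvPolynomial_symAction (b : Module.Basis ι k V) (g : V ≃ₗ[k] V)
    (f : SymmetricAlgebra k V) :
    SymmetricAlgebra.equivMvPolynomial b (symAction g f) =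
      linSubst (LinearMap.toMatrix b b g) (SymmetricAlgebra.equivMvPolynomial b f) := by
  have h : ((SymmetricAlgebra.equivMvPolynomial b).toAlgHom.comp (symAction g)) =
      (linSubst (LinearMap.toMatrix b b g)).comp
        (SymmetricAlgebra.equivMvPolynomial b).toAlgHom := by
    refine SymmetricAlgebra.algHom_ext (b.ext fun i => ?_)
    change SymmetricAlgebra.equivMvPolynomial b (symAction g (SymmetricAlgebra.ι k V (b i))) =
      linSubst (LinearMap.toMatrix b b g)
        (SymmetricAlgebra.equivMvPolynomial b (SymmetricAlgebra.ι k V (b i)))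
    rw [symAction, SymmetricAlgebra.lift_ι_apply, LinearMap.comp_apply,
      SymmetricAlgebra.equivMvPolynomial_ι_eq_sum, SymmetricAlgebra.equivMvPolynomial_ι_apply,
      linSubst_X]
    simp only [LinearMap.toMatrix_apply]
  exact DFunLike.congr_fun h f

/-- The matrix representation of the group of an arrangement in a given basis. -/
def matrixRepresentation (A : ArrangementData k V) (b : Module.Basis ι k V) :
    A.G →* Matrix ι ι k where
  toFun g := LinearMap.toMatrix b b g.1
  map_one' := LinearMap.toMatrix_one b
  map_mul' g h := LinearMap.toMatrix_mul b g.1 h.1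

/-- The matrices of `ρ` are those of the group of `A` in the basis `b`. -/
def IsRepresentedBy {H : Type*} [Group H] (A : ArrangementData k V) (b : Module.Basis ι k V)
    (ρ : H →* Matrix ι ι k) : Prop :=
  Set.range ρ = (fun g : V ≃ₗ[k] V => LinearMap.toMatrix b b g) '' A.G

theorem isRepresentedBy_matrixRepresentation (A : ArrangementData k V) (b : Module.Basis ι k V) :
    A.IsRepresentedBy b (A.matrixRepresentation b) := by
  ext M
  constructor
  · rintro ⟨g, rfl⟩
    exact ⟨g.1, g.2, rfl⟩
  · rintro ⟨g, hg, rfl⟩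
    exact ⟨⟨g, hg⟩, rfl⟩

/-- Invariants depend only on the set of matrices. A representation of the group over `T` can thus
stand for its image over `F`, without knowing that reduction is injective. -/
theorem IsRepresentedBy.polyInvariants_eq {H : Type*} [Group H] {A : ArrangementData k V}
    {b : Module.Basis ι k V} {ρ : H →* Matrix ι ι k} (h : A.IsRepresentedBy b ρ) :
    polyInvariants ρ = A.invariants.map (SymmetricAlgebra.equivMvPolynomial b).toAlgHom := by
  have key : ∀ f, SymmetricAlgebra.equivMvPolynomial b f ∈ polyInvariants ρ ↔ f ∈ A.invariants := by
    intro f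
    constructor
    · intro hf g hg
      obtain ⟨s, hs⟩ := h.ge ⟨g, hg, rfl⟩
      apply (SymmetricAlgebra.equivMvPolynomial b).injective
      rw [equivMvPolynomial_symAction]
      exact (congrArg (fun M => linSubst M _) hs).symm.trans (hf s)
    · intro hf s
      obtain ⟨g, hg, hs⟩ := h.le ⟨s, rfl⟩
      rw [← hs, ← equivMvPolynomial_symAction, hf g hg]
  ext p
  rw [Subalgebra.mem_map]
  constructor
  · intro hp
    refine ⟨(SymmetricAlgebra.equivMvPolynomial b).symm p, (key _).1 ?_,
      (SymmetricAlgebra.equivMvPolynomial b).apply_symm_apply p⟩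
    rwa [AlgEquiv.apply_symm_apply]
  · rintro ⟨f, hf, rfl⟩
    exact (key f).2 hf

theorem IsRepresentedBy.baseChange {H S : Type*} [Group H] [CommRing S] [Algebra k S]
    {A : ArrangementData k V} {b : Module.Basis ι k V} {ρ : H →* Matrix ι ι k}
    (h : A.IsRepresentedBy b ρ) :
    (A.baseChange S).IsRepresentedBy (b.baseChange S) (mapRepresentation (algebraMap k S) ρ) := by
  have h1 : ∀ g : V ≃ₗ[k] V, LinearMap.toMatrix (b.baseChange S) (b.baseChange S)
      (extendScalarsHom k S V g : S ⊗[k] V →ₗ[S] S ⊗[k] V) =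
        (LinearMap.toMatrix b b (g : V →ₗ[k] V)).map (algebraMap k S) := by
    intro g
    ext i j
    have h2 : (extendScalarsHom k S V g) ((1 : S) ⊗ₜ[k] b j) = (1 : S) ⊗ₜ[k] g (b j) := rfl
    rw [LinearMap.toMatrix_apply, Module.Basis.baseChange_apply, LinearEquiv.coe_coe, h2,
      Module.Basis.baseChange_repr_tmul, Matrix.map_apply, LinearMap.toMatrix_apply,
      LinearEquiv.coe_coe, Algebra.smul_def, mul_one]
  ext M
  constructor
  · rintro ⟨s, rfl⟩
    obtain ⟨g, hg, hs⟩ := h.le ⟨s, rfl⟩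
    exact ⟨extendScalarsHom k S V g, ⟨g, hg, rfl⟩, by
      rw [mapRepresentation_apply, ← hs]; exact h1 g⟩
  · rintro ⟨_, ⟨g, hg, rfl⟩, rfl⟩
    obtain ⟨s, hs⟩ := h.ge ⟨g, hg, rfl⟩
    exact ⟨s, by rw [mapRepresentation_apply, hs]; exact (h1 g).symm⟩

theorem IsRepresentedBy.transport {H W : Type*} [Group H] [AddCommGroup W] [Module k W]
    {A : ArrangementData k V} {b : Module.Basis ι k V} {ρ : H →* Matrix ι ι k}
    (h : A.IsRepresentedBy b ρ) (e : V ≃ₗ[k] W) :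
    (A.transport e).IsRepresentedBy (b.map e) ρ := by
  have h1 : ∀ g : V ≃ₗ[k] V, LinearMap.toMatrix (b.map e) (b.map e)
      (conjugationHom e g : W →ₗ[k] W) = LinearMap.toMatrix b b (g : V →ₗ[k] V) := by
    intro g
    ext i j
    simp [LinearMap.toMatrix_apply, conjugationHom]
  rw [IsRepresentedBy, h]
  ext M
  constructor
  · rintro ⟨g, hg, rfl⟩
    exact ⟨conjugationHom e g, ⟨g, hg, rfl⟩, h1 g⟩
  · rintro ⟨_, ⟨g, hg, rfl⟩, rfl⟩
    exact ⟨g, hg, (h1 g).symm⟩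

end

/-! ### Degrees of an arrangement over a field -/

section Field

variable {k V : Type*} [Field k] [AddCommGroup V] [Module k V] {A : ArrangementData k V}

theorem IsRepresentedBy.hasDegrees_iff {n : ℕ} {H : Type*} [Group H]
    {b : Module.Basis (Fin n) k V} {ρ : H →* Matrix (Fin n) (Fin n) k} (h : A.IsRepresentedBy b ρ)
    {d : Multiset ℕ} : A.HasDegrees d ↔
      ∃ (f : Fin n → MvPolynomial (Fin n) k) (deg : Fin n → ℕ), AlgebraicIndependent k f ∧
        Algebra.adjoin k (Set.range f) = polyInvariants ρ ∧ (∀ i, (f i).IsHomogeneous (deg i)) ∧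
          d = Finset.univ.val.map deg := by
  obtain rfl : Module.finrank k V = n := by simpa using Module.finrank_eq_card_basis b
  set E := SymmetricAlgebra.equivMvPolynomial b with hE
  have hadj : ∀ f : Fin (Module.finrank k V) → SymmetricAlgebra k V,
      Algebra.adjoin k (Set.range (E ∘ f)) = (Algebra.adjoin k (Set.range f)).map E.toAlgHom := by
    intro f
    rw [AlgHom.map_adjoin, Set.range_comp]
    rfl
  constructor
  · rintro ⟨f, deg, hf, hfA, hdeg, rfl⟩
    refine ⟨E ∘ f, deg, hf.map' (f := E.toAlgHom) E.injective, ?_, fun i => ?_, rfl⟩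
    · rw [hadj, hfA, h.polyInvariants_eq]
    · exact (SymmetricAlgebra.mem_range_ι_pow_iff b _ _).1 (hdeg i)
  · rintro ⟨f, deg, hf, hfA, hdeg, rfl⟩
    have hff : E ∘ (E.symm ∘ f) = f := by
      ext1 i
      exact E.apply_symm_apply _
    refine ⟨E.symm ∘ f, deg, hf.map' (f := E.symm.toAlgHom) E.symm.injective, ?_, fun i => ?_, rfl⟩
    · apply Subalgebra.map_injective (f := E.toAlgHom) E.injective
      rw [← hadj, hff, hfA, h.polyInvariants_eq]
    · rw [SymmetricAlgebra.mem_range_ι_pow_iff b]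
      have h1 : E ((E.symm ∘ f) i) = f i := congrFun hff i
      exact h1.symm ▸ hdeg i

theorem IsRepresentedBy.exists_weightCount_eq {n : ℕ} {H : Type*} [Group H]
    {b : Module.Basis (Fin n) k V} {ρ : H →* Matrix (Fin n) (Fin n) k} (h : A.IsRepresentedBy b ρ)
    {d : Multiset ℕ} (hd : A.HasDegrees d) :
    ∃ deg : Fin n → ℕ, d = Finset.univ.val.map deg ∧ (∀ i, deg i ≠ 0) ∧
      ∀ m, weightCount deg m = Module.finrank k
        ↥(Subalgebra.toSubmodule (polyInvariants ρ) ⊓ homogeneousSubmodule (Fin n) k m) := by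
  obtain ⟨f, deg, hf, hfA, hdeg, rfl⟩ := h.hasDegrees_iff.1 hd
  exact ⟨deg, rfl, ne_zero_of_algebraicIndependent hf hdeg, fun m =>
    hfA ▸ (finrank_adjoin_inf_homogeneousSubmodule hf hdeg m).symm⟩

theorem HasDegrees.unique [FiniteDimensional k V] {d d' : Multiset ℕ} (hd : A.HasDegrees d)
    (hd' : A.HasDegrees d') : d = d' := by
  have h := A.isRepresentedBy_matrixRepresentation (Module.finBasis k V)
  obtain ⟨deg, rfl, h0, h1⟩ := h.exists_weightCount_eq hd
  obtain ⟨deg', rfl, h0', h1'⟩ := h.exists_weightCount_eq hd'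
  exact eq_of_weightCount_eq h0 h0' fun m => (h1 m).trans (h1' m).symm

/-- As `s - 1` kills a hyperplane, its image is the line spanned by `v = s x₀ - x₀`, nonzero because
`s ≠ 1`. The linear form `L` is `v` seen in `S(V)`. -/
theorem actsAsReflection_of_isLinearReflection {n : ℕ} (b : Module.Basis (Fin n) k V) (s : A.G)
    (hs : IsLinearReflection s.1) : ActsAsReflection (A.matrixRepresentation b) s := by
  obtain ⟨h2, l, hl, hls⟩ := hs
  obtain ⟨x₀, hx₀⟩ : ∃ x, l x ≠ 0 := by
    by_contra! h
    exact hl (LinearMap.ext h)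
  set v := s.1 x₀ - x₀ with hv
  have key : ∀ x, s.1 x - x = (l x / l x₀) • v := by
    intro x
    have h := hls (x - (l x / l x₀) • x₀) (by
      rw [map_sub, map_smul, smul_eq_mul, div_mul_cancel₀ _ hx₀, sub_self])
    rw [map_sub, map_smul] at h
    rw [hv, smul_sub, sub_eq_sub_iff_sub_eq_sub]
    exact h
  have hv0 : v ≠ 0 := by
    intro h
    have h1 : s.1 = 1 := LinearEquiv.ext fun x => sub_eq_zero.1 ((key x).trans (by rw [h, smul_zero]))
    rw [h1, orderOf_one] at h2
    exact absurd h2 (by norm_num)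
  have hhom : ∀ v, (SymmetricAlgebra.equivMvPolynomial b
      (SymmetricAlgebra.ι k V v)).IsHomogeneous 1 := fun v =>
    (SymmetricAlgebra.mem_range_ι_pow_iff b _ _).1 (by rw [pow_one]; exact ⟨v, rfl⟩)
  refine ⟨SymmetricAlgebra.equivMvPolynomial b (SymmetricAlgebra.ι k V v), fun h => hv0 ?_,
    hhom v, fun i => ?_⟩
  · rw [SymmetricAlgebra.equivMvPolynomial_ι_eq_sum] at h
    refine b.repr.map_eq_zero_iff.1 (Finsupp.ext fun j => ?_)
    have := congrArg (coeff (Finsupp.single j 1)) h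
    simpa [coeff_sum, coeff_C_mul, coeff_X, Finsupp.single_left_inj] using this
  · rw [← SymmetricAlgebra.equivMvPolynomial_ι_apply b i]
    change _ ∣ linSubst (LinearMap.toMatrix b b s.1) _ - _
    rw [← equivMvPolynomial_symAction, symAction, SymmetricAlgebra.lift_ι_apply,
      LinearMap.comp_apply, LinearEquiv.coe_coe, ← map_sub, ← map_sub, key, map_smul, map_smul,
      smul_eq_C_mul]
    exact dvd_mul_left _ _

theorem IsCoxeter.exists_hasDegrees [FiniteDimensional k V] (hA : A.IsCoxeter)
    (hG : (Nat.card A.G : k) ≠ 0) : ∃ d, A.HasDegrees d := by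
  have := hA.finite
  have := Fintype.ofFinite A.G
  rw [Nat.card_eq_fintype_card] at hG
  set b := Module.finBasis k V
  have hgen : Subgroup.closure {s | ActsAsReflection (A.matrixRepresentation b) s} = ⊤ := by
    rw [eq_top_iff]
    rintro ⟨g, hg⟩ -
    -- Membership is part of the claim so that induction on the closure in `GL(V)` yields generation
    -- of the group `A.G` itself.
    have h : ∃ hg : g ∈ A.G, (⟨g, hg⟩ : A.G) ∈
        Subgroup.closure {s | ActsAsReflection (A.matrixRepresentation b) s} := by
      rw [← hA.generated] at hg
      induction hg using Subgroup.closure_induction with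
      | mem s hs =>
        exact ⟨hs.1, Subgroup.subset_closure
          (actsAsReflection_of_isLinearReflection b ⟨s, hs.1⟩ hs.2)⟩
      | one => exact ⟨A.G.one_mem, Subgroup.one_mem _⟩
      | mul x y _ _ hx hy =>
        obtain ⟨hx, hx'⟩ := hx
        obtain ⟨hy, hy'⟩ := hy
        exact ⟨A.G.mul_mem hx hy, Subgroup.mul_mem _ hx' hy'⟩
      | inv x _ hx =>
        obtain ⟨hx, hx'⟩ := hx
        exact ⟨A.G.inv_mem hx, Subgroup.inv_mem _ hx'⟩
    exact h.2
  obtain ⟨f, deg, hf, hfA, hdeg⟩ := exists_algebraicIndependent_generators hG hgen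
  exact ⟨_, (A.isRepresentedBy_matrixRepresentation b).hasDegrees_iff.2
    ⟨f, deg, hf, hfA, hdeg, rfl⟩⟩

end Field

end ArrangementData

/-! ### Comparison with a lifting -/

/-- The kernel of `T → F` is the maximal ideal of the local ring `T`, so a nonunit `N` vanishes in
`F`, which means `p ∣ N`. -/
theorem IsLiftingRing.isUnit_natCast {T F : Type*} [CommRing T] [IsDomain T] [Field F]
    [Algebra T ℂ] [Algebra T F] (h : IsLiftingRing T F) (p : ℕ) [CharP F p] {N : ℕ}
    (hN : ¬ p ∣ N) : IsUnit (N : T) := by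
  have := h.isDiscreteValuationRing
  by_contra hu
  have hker := IsLocalRing.eq_maximalIdeal (RingHom.ker_isMaximal_of_surjective _ h.residueField)
  have h1 : (N : T) ∈ RingHom.ker (algebraMap T F) := by
    rw [hker]
    exact hu
  rw [RingHom.mem_ker, map_natCast, CharP.cast_eq_zero_iff F p] at h1
  exact hN h1

namespace ArrangementData

/-- The degrees of an arrangement and of a lifting with group of order invertible in the residue field
agree. -/
theorem IsLifting.hasDegrees_eq {T F M V : Type*} [CommRing T] [IsDomain T] [Field F] [Algebra T ℂ]
    [Algebra T F] [AddCommGroup M] [Module T M] [Module.Free T M] [Module.Finite T M]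
    [AddCommGroup V] [Module F V] {B : ArrangementData T M} {A : ArrangementData F V}
    (hT : IsLiftingRing T F) (h : B.IsLifting A) (p : ℕ) [CharP F p] (hp : ¬ p ∣ Nat.card B.G)
    {d d' : Multiset ℕ} (hd : A.HasDegrees d) (hd' : (B.baseChange ℂ).HasDegrees d') : d = d' := by
  obtain ⟨hB, e, rfl⟩ := h
  have := hT.isDiscreteValuationRing
  have := hB.isCoxeter.finite
  have := Fintype.ofFinite B.G
  have hu := hT.isUnit_natCast p hp
  rw [Nat.card_eq_fintype_card] at hu
  -- One matrix representation over `T` yields both arrangements, so both Hilbert functions equal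
  -- the rank function over `T`.
  have hρ := B.isRepresentedBy_matrixRepresentation (Module.finBasis T M)
  obtain ⟨deg, rfl, h0, h1⟩ := ((hρ.baseChange (S := F)).transport e).exists_weightCount_eq hd
  obtain ⟨deg', rfl, h0', h1'⟩ := (hρ.baseChange (S := ℂ)).exists_weightCount_eq hd'
  exact eq_of_weightCount_eq h0 h0' fun m => by
    rw [h1, h1', finrank_polyInvariants_map _ _ hu, finrank_polyInvariants_map _ _ hu]

end ArrangementData

end
theorem proposition1p5 {F V : Type*} [Field F] [Finite F] (p : ℕ) [CharP F p] (hp : p ≠ 2)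
    [AddCommGroup V] [Module F V] [FiniteDimensional F V] (A : ArrangementData F V)
    (hA : A.IsCoxeter) (hlift : A.IsLiftable) (hG : ¬ p ∣ Nat.card A.G) :
    ∃ d : Multiset ℕ,
      (∀ d', A.HasDegrees d' ↔ d' = d) ∧
      ∀ (T M : Type*) [CommRing T] [IsDomain T] [Algebra T ℂ] [Algebra T F]
        [AddCommGroup M] [Module T M] [Module.Free T M] [Module.Finite T M]
        (B : ArrangementData T M),
        IsLiftingRing T F → B.IsLifting A → ¬ p ∣ Nat.card B.G →
        ∀ d', (B.baseChange ℂ).HasDegrees d' ↔ d' = d := by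
  obtain ⟨d, hd⟩ := hA.exists_hasDegrees (by rwa [Ne, CharP.cast_eq_zero_iff F p])
  refine ⟨d, fun d' => ⟨fun h => h.unique hd, fun h => h ▸ hd⟩, ?_⟩
  intro T M _ _ _ _ _ _ _ _ B hT hB hpB d'
  have hfin := hB.1.isComplexCoxeter.1.finite
  -- In characteristic zero the order of the group is invertible, so degrees exist over `ℂ` as well.
  obtain ⟨d₁, hd₁⟩ := hB.1.isComplexCoxeter.1.exists_hasDegrees
    (Nat.cast_ne_zero.2 Nat.card_pos.ne')
  have h := hB.hasDegrees_eq hT p hpB hd hd₁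
  exact ⟨fun h' => (hB.hasDegrees_eq hT p hpB hd h').symm, fun h' => h' ▸ h ▸ hd₁⟩
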